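/- Let $w:\mathbb{R}\to\mathbb{R}$ be bounded, non-negative, even and integrable with $\int_{\mathbb{R}} w(x)\,dx=1$ and $\int_{\mathbb{R}}|x|\,w(x)\,dx<\infty$. Assume that there is $W\in(0,+\infty]$ such that $w>0$ on $(-W,W)$ and $w=0$ off $[-W,W]$. Let $h_f,h_g:[0,1]\to[0,1]$ be non-decreasing with $h_f(0)=h_g(0)=0$ and $h_f(1)=h_g(1)=1$. For such an $h$ write $h^{-1}(v)=\inf\{u\in[0,1]: h(u)\ge v\}$, and write $h(u\pm)$ for its one-sided limits, with $h(0-)=h(0)$ and $h(1+)=h(1)$. For $u,v\in[0,1]$ put $$\phi(u,v)=\int_0^u h_g^{-1}(u')\,du'+\int_0^v h_f^{-1}(v')\,dv'-uv ,$$ and assume the strictly positive gap condition: $\phi(1,1)=0$, and $\phi(u,v)>0$ for all $(u,v)\in[0,1]^2\setminus\{(0,0),(1,1)\}$. A function $p:\mathbb{R}\to[0,1]$ is called an interpolating profile if $\lim_{x\to-\infty}p(x)=0$ and $\lim_{x\to+\infty}p(x)=1$. Write $p^w(x)=\int_{\mathbb{R}}p(y)\,w(x-y)\,dy$. A pair $(f,g)$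 of interpolating profiles is called a consistent fixed point (CFP) if for almost every $x\in\mathbb{R}$ $$f(x)\in\big[h_f(g^w(x)-),\,h_f(g^w(x)+)\big]\quad\text{and}\quad g(x)\in\big[h_g(f^w(x)-),\,h_g(f^w(x)+)\big].$$ Let $(f_0,g_0)$ and $(f_1,g_1)$ be two CFPs (for the same $w,h_f,h_g$) all four of whose components are non-decreasing. Then there is $m\in\mathbb{R}$ such that for almost all $x\in\mathbb{R}$ $$f_1(x)=f_0(x+m)\quad\text{and}\quad g_1(x)=g_0(x+m).$$ -/

import Mathlib

open MeasureTheory Filter Topology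

noncomputable section

namespace SpatialCoupling

/-- An averaging window: bounded, non-negative, even, integrable, of integral `1`. -/
structure IsWindow (w : ℝ → ℝ) : Prop where
  bounded : ∃ C : ℝ, ∀ x, w x ≤ C
  nonneg : ∀ x, 0 ≤ w x
  even : ∀ x, w (-x) = w x
  integrable : Integrable w
  integral_eq_one : ∫ x, w x = 1

/-- Finiteness of `C_w = ∫ |x| w(x) dx`. -/
def FiniteCw (w : ℝ → ℝ) : Prop := Integrable (fun x : ℝ => |x| * w x)

/-- The interval support condition: for some `0 < W ≤ +∞`, the window is strictly positive on
`(-W, W)` and zero off `[-W, W]` (nothing is said about the value at `±W`). -/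
def IntervalSupport (w : ℝ → ℝ) : Prop :=
  ∃ W : EReal, 0 < W ∧ (∀ x : ℝ, ((|x| : ℝ) : EReal) < W → 0 < w x) ∧
    (∀ x : ℝ, W < ((|x| : ℝ) : EReal) → w x = 0)

/-- The averaged profile `p^w(x) = ∫ p(y) w(x - y) dy`. -/
def windowAverage (p w : ℝ → ℝ) : ℝ → ℝ :=
  convolution p w (ContinuousLinearMap.mul ℝ ℝ) volume

/-- An update function: a non-decreasing map `[0,1] → [0,1]` fixing `0` and `1`. -/
structure IsUpdate (h : unitInterval → unitInterval) : Prop where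
  mono : Monotone h
  map_zero : h 0 = 0
  map_one : h 1 = 1

/-- An update function as a real function on `ℝ`, constant to the left of `0` and to the right
of `1`; so the left limit at `0` is `h 0` and the right limit at `1` is `h 1`. -/
def realExt (h : unitInterval → unitInterval) : ℝ → ℝ :=
  Set.IccExtend (zero_le_one' ℝ) (fun u => (h u : ℝ))

/-- The generalized inverse `h⁻¹(v) = inf {u ∈ [0,1] : v ≤ h(u)}` for `v ∈ [0,1]`. Any other
choice of inverse of the monotone graph differs from it only on a countable set of `v`. -/
def genInv (h : unitInterval → unitInterval) (v : ℝ) : ℝ :=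
  sInf {u : ℝ | ∃ hu : u ∈ unitInterval, v ≤ (h ⟨u, hu⟩ : ℝ)}

/-- The potential `φ(h_f, h_g; u, v) = ∫₀ᵘ h_g⁻¹ + ∫₀ᵛ h_f⁻¹ - u v`. -/
def potential (hf hg : unitInterval → unitInterval) (u v : ℝ) : ℝ :=
  (∫ u' in (0 : ℝ)..u, genInv hg u') + (∫ v' in (0 : ℝ)..v, genInv hf v') - u * v

/-- The strictly positive gap condition. -/
def StrictlyPositiveGap (hf hg : unitInterval → unitInterval) : Prop :=
  potential hf hg 1 1 = 0 ∧
    ∀ u ∈ Set.Icc (0 : ℝ) 1, ∀ v ∈ Set.Icc (0 : ℝ) 1,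
      (u, v) ≠ (0, 0) → (u, v) ≠ (1, 1) → 0 < potential hf hg u v

/-- An interpolating profile: `p : ℝ → [0,1]` with limit `0` at `-∞` and `1` at `+∞`. -/
structure IsInterpolating (p : ℝ → ℝ) : Prop where
  mem_Icc : ∀ x, p x ∈ Set.Icc (0 : ℝ) 1
  tendsto_atBot : Tendsto p atBot (𝓝 0)
  tendsto_atTop : Tendsto p atTop (𝓝 1)

/-- The relation `v ≐ h(u)`: `v ∈ [h(u-), h(u+)]`, which is `v = h(u)` where `h` is
continuous. -/
def Consistent (h : unitInterval → unitInterval) (u v : ℝ) : Prop :=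
  v ∈ Set.Icc (Function.leftLim (realExt h) u) (Function.rightLim (realExt h) u)

/-- A consistent fixed point: an interpolating pair with `f ≐ h_f ∘ g^w` and `g ≐ h_g ∘ f^w`
almost everywhere. -/
structure IsCFP (hf hg : unitInterval → unitInterval) (w f g : ℝ → ℝ) : Prop where
  interp_f : IsInterpolating f
  interp_g : IsInterpolating g
  eq_f : ∀ᵐ x : ℝ, Consistent hf (windowAverage g w x) (f x)
  eq_g : ∀ᵐ x : ℝ, Consistent hg (windowAverage f w x) (g x)

end SpatialCoupling

end

/-! Let Ω be the distribution function of w, and let x, y be the quantile functions of f, g. By the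
layer-cake formula the fixed point equations become ∫ Ω(x(v) - y(u)) du = h_f⁻¹(v) and ∫ Ω(y(u) -
x(v)) dv = h_g⁻¹(u) for u, v in (0,1) (`integral_windowCdf_quantile`). The right sides are the same
for every monotone CFP.

For two CFPs, D(u,v) = Ω(x₁(v) - y₁(u)) - Ω(x₀(v) - y₀(u)) therefore integrates to zero in each
variable separately, so it is orthogonal to A(v) - B(u), where A, B are the arctangents of the
displacements x₁ - x₀ and y₁ - y₀. Since Ω is monotone, D · (A - B) ≥ 0, hence it vanishes. Since Ω
is injective where 0 < Ω < 1, the two displacements agree at every interacting pair, one with 0 <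
Ω(x₀(v) - y₀(u)) < 1 (`displacement_eq`).

The gap condition makes interaction connected: without interaction across a splitting (c,d), the
equations and Ω(z) + Ω(-z) = 1 would force φ(c,d) = 0 (`exists_interaction_of_potential_pos`).
Interacting pairs thus bridge every relevant position, the displacement is a single constant
(`displacement_const`), and the profiles are translates. -/

noncomputable section

namespace SpatialCoupling

open Set

/-! ### The distribution function of a window -/

/-- The distribution function `z ↦ ∫_{-∞}^z w` of a window. -/
def windowCdf (w : ℝ → ℝ) (z : ℝ) : ℝ := ∫ t in Iic z, w t

section WindowCdf

variable {w : ℝ → ℝ}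

theorem windowCdf_sub (hw : IsWindow w) (s t : ℝ) :
    windowCdf w t - windowCdf w s = ∫ r in s..t, w r :=
  intervalIntegral.integral_Iic_sub_Iic hw.integrable.integrableOn hw.integrable.integrableOn

theorem windowCdf_mono (hw : IsWindow w) : Monotone (windowCdf w) := by
  intro s t hst
  have h := windowCdf_sub hw s t
  have : 0 ≤ ∫ r in s..t, w r :=
    intervalIntegral.integral_nonneg hst fun r _ => hw.nonneg r
  linarith

theorem windowCdf_continuous (hw : IsWindow w) : Continuous (windowCdf w) := by
  have h : windowCdf w = fun t => windowCdf w 0 + ∫ r in (0 : ℝ)..t, w r := by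
    funext t
    linarith [windowCdf_sub hw 0 t]
  rw [h]
  exact continuous_const.add
    (intervalIntegral.continuous_primitive (fun _ _ => hw.integrable.intervalIntegrable) 0)

theorem windowCdf_nonneg (hw : IsWindow w) (z : ℝ) : 0 ≤ windowCdf w z :=
  integral_nonneg fun t => hw.nonneg t

theorem windowCdf_neg (hw : IsWindow w) (z : ℝ) : windowCdf w (-z) = 1 - windowCdf w z := by
  have h1 := integral_comp_neg_Iic (-z) w
  simp only [hw.even, neg_neg] at h1
  have h2 := intervalIntegral.integral_Iic_add_Ioi (b := z) hw.integrable.integrableOn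
    hw.integrable.integrableOn
  rw [hw.integral_eq_one] at h2
  simp only [windowCdf]
  linarith

theorem windowCdf_sub_comm (hw : IsWindow w) (s t : ℝ) :
    windowCdf w (s - t) = 1 - windowCdf w (t - s) := by
  rw [← windowCdf_neg hw, neg_sub]

theorem windowCdf_le_one (hw : IsWindow w) (z : ℝ) : windowCdf w z ≤ 1 := by
  linarith [windowCdf_neg hw z, windowCdf_nonneg hw (-z)]

theorem abs_windowCdf_le_one (hw : IsWindow w) (z : ℝ) : |windowCdf w z| ≤ 1 :=
  abs_le.2 ⟨by linarith [windowCdf_nonneg hw z], windowCdf_le_one hw z⟩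

theorem windowCdf_zero (hw : IsWindow w) : windowCdf w 0 = 1 / 2 := by
  have h := windowCdf_neg hw 0
  rw [neg_zero] at h
  linarith

theorem windowCdf_eq_zero {W : EReal} (hW : ∀ x : ℝ, W < ((|x| : ℝ) : EReal) → w x = 0)
    {s : ℝ} (hs : s ≤ 0) (h : W ≤ ((|s| : ℝ) : EReal)) : windowCdf w s = 0 := by
  -- The open half-line avoids `t = s`, where |s| = W is possible and `w` is unspecified.
  rw [windowCdf, integral_Iic_eq_integral_Iio]
  refine setIntegral_eq_zero_of_forall_eq_zero fun t ht => hW t (h.trans_lt ?_)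
  have ht : t < s := ht
  rw [EReal.coe_lt_coe_iff, abs_of_nonpos hs, abs_of_nonpos (ht.le.trans hs)]
  linarith

/-- A value strictly between 0 and 1 forces |s| < W, so `w` is positive just to the right of `s`. -/
theorem windowCdf_lt_of_lt (hw : IsWindow w) (hsupp : IntervalSupport w) {s t : ℝ}
    (h0 : 0 < windowCdf w s) (h1 : windowCdf w s < 1) (hst : s < t) :
    windowCdf w s < windowCdf w t := by
  obtain ⟨W, -, hpos, hzero⟩ := hsupp
  have hs : ((|s| : ℝ) : EReal) < W := by
    by_contra! hc
    rcases le_total s 0 with h | h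
    · exact h0.ne' (windowCdf_eq_zero hzero h hc)
    · have := windowCdf_eq_zero hzero (s := -s) (by linarith) (by rwa [abs_neg])
      linarith [windowCdf_neg hw s]
  obtain ⟨q, hq1, hq2⟩ := EReal.lt_iff_exists_real_btwn.1 hs
  rw [EReal.coe_lt_coe_iff] at hq1
  have hlt : s < min t q := lt_min hst ((le_abs_self s).trans_lt hq1)
  have hint : 0 < ∫ r in s..min t q, w r := by
    refine intervalIntegral.intervalIntegral_pos_of_pos_on
      hw.integrable.intervalIntegrable (fun r hr => hpos r (lt_of_le_of_lt ?_ hq2)) hlt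
    rw [EReal.coe_le_coe_iff, abs_le]
    exact ⟨by linarith [hr.1, neg_abs_le s], hr.2.le.trans (min_le_right _ _)⟩
  have := windowCdf_sub hw s (min t q)
  linarith [windowCdf_mono hw (min_le_left t q)]

/-- Where it lies strictly between `0` and `1`, the distribution function of a window takes each
value only once. -/
theorem eq_of_windowCdf_eq (hw : IsWindow w) (hsupp : IntervalSupport w) {s t : ℝ}
    (h0 : 0 < windowCdf w s) (h1 : windowCdf w s < 1) (h : windowCdf w s = windowCdf w t) :
    s = t := by
  rcases lt_trichotomy s t with hlt | heq | hgt
  · exact absurd h (windowCdf_lt_of_lt hw hsupp h0 h1 hlt).ne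
  · exact heq
  · exact absurd h.symm (windowCdf_lt_of_lt hw hsupp (h ▸ h0) (h ▸ h1) hgt).ne

end WindowCdf

/-! ### Quantile functions of profiles -/

/-- The quantile function of a profile, meaningful on `(0, 1)`. -/
def quantile (p : ℝ → ℝ) (v : ℝ) : ℝ := sInf {t | v ≤ p t}

section Quantile

variable {p : ℝ → ℝ}

theorem quantile_bddBelow (hm : Monotone p) (hp : IsInterpolating p) {v : ℝ} (hv : 0 < v) :
    BddBelow {t | v ≤ p t} := by
  obtain ⟨s, hs⟩ := (hp.tendsto_atBot.eventually_lt_const hv).exists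
  exact ⟨s, fun t ht => le_of_not_gt fun hts => (hs.trans_le ht).not_ge (hm hts.le)⟩

theorem quantile_le (hm : Monotone p) (hp : IsInterpolating p) {v t : ℝ} (hv : 0 < v)
    (h : v ≤ p t) : quantile p v ≤ t :=
  csInf_le (quantile_bddBelow hm hp hv) h

theorem lt_of_lt_quantile (hm : Monotone p) (hp : IsInterpolating p) {v t : ℝ} (hv : 0 < v)
    (h : t < quantile p v) : p t < v :=
  lt_of_not_ge fun hc => h.not_ge (quantile_le hm hp hv hc)

theorem le_of_quantile_lt (hm : Monotone p) (hp : IsInterpolating p) {v t : ℝ} (hv : v < 1)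
    (h : quantile p v < t) : v ≤ p t := by
  have hne : {t | v ≤ p t}.Nonempty := by
    obtain ⟨s, hs⟩ := (hp.tendsto_atTop.eventually_const_lt hv).exists
    exact ⟨s, hs.le⟩
  obtain ⟨s, hs, hst⟩ := exists_lt_of_csInf_lt hne h
  exact le_trans hs (hm hst.le)

theorem le_quantile (hm : Monotone p) (hp : IsInterpolating p) {v t : ℝ} (hv : v < 1)
    (h : p t < v) : t ≤ quantile p v :=
  le_of_not_gt fun hc => h.not_ge (le_of_quantile_lt hm hp hv hc)

theorem quantile_monotoneOn (hm : Monotone p) (hp : IsInterpolating p) :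
    MonotoneOn (quantile p) (Ioo 0 1) := by
  intro u hu v hv huv
  refine le_of_forall_gt_imp_ge_of_dense fun t ht => ?_
  exact quantile_le hm hp hu.1 (huv.trans (le_of_quantile_lt hm hp hv.2 ht))

theorem quantile_aemeasurable (hm : Monotone p) (hp : IsInterpolating p) :
    AEMeasurable (quantile p) (volume.restrict (Ioo 0 1)) :=
  aemeasurable_restrict_of_monotoneOn measurableSet_Ioo (quantile_monotoneOn hm hp)

/-- This regularity later turns almost-everywhere identities between quantiles into identities at
every point. -/
theorem quantile_leftContinuous (hm : Monotone p) (hp : IsInterpolating p) {v : ℝ}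
    (hv : v ∈ Ioo (0 : ℝ) 1) : ContinuousWithinAt (quantile p) (Iio v) v := by
  refine tendsto_order.2 ⟨fun s hs => ?_, fun s hs => ?_⟩
  · obtain ⟨r, hsr, hr⟩ := exists_between hs
    have hpr := lt_of_lt_quantile hm hp hv.1 hr
    filter_upwards [Ioo_mem_nhdsLT (max_lt hpr hv.1)] with u hu
    exact hsr.trans_le
      (le_quantile hm hp (hu.2.trans hv.2) ((le_max_left _ _).trans_lt hu.1))
  · filter_upwards [Ioo_mem_nhdsLT hv.1] with u hu
    exact (quantile_monotoneOn hm hp ⟨hu.1, hu.2.trans hv.2⟩ hv hu.2.le).trans_lt hs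

/-- Layer-cake form of the averaged profile. -/
theorem windowAverage_eq {w : ℝ → ℝ} (hw : IsWindow w) (hm : Monotone p)
    (hp : IsInterpolating p) (x : ℝ) :
    windowAverage p w x = ∫ u in Ioo (0 : ℝ) 1, windowCdf w (x - quantile p u) := by
  have hwx : Integrable fun t => w (x - t) := hw.integrable.comp_sub_left x
  have hmeas : MeasurableSet {z : ℝ × ℝ | z.2 ≤ p z.1} :=
    measurableSet_le measurable_snd (hm.measurable.comp measurable_fst)
  have hind : Integrable (Function.uncurry fun t u : ℝ =>
      ({z : ℝ × ℝ | z.2 ≤ p z.1}.indicator (fun z => w (x - z.1)) (t, u)))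
      (volume.prod (volume.restrict (Ioo (0 : ℝ) 1))) :=
    (hwx.comp_fst (volume.restrict (Ioo (0 : ℝ) 1))).indicator hmeas
  calc windowAverage p w x
      = ∫ t, ∫ u in Ioo (0 : ℝ) 1,
          {z : ℝ × ℝ | z.2 ≤ p z.1}.indicator (fun z => w (x - z.1)) (t, u) := by
        simp only [windowAverage, convolution, ContinuousLinearMap.mul_apply']
        refine integral_congr_ae (ae_of_all _ fun t => ?_)
        -- `p t` is the length of the set of `u` in (0,1) with `u ≤ p t`.
        have h1 : ∀ u, {z : ℝ × ℝ | z.2 ≤ p z.1}.indicator (fun z => w (x - z.1)) (t, u)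
            = (Iic (p t)).indicator (fun _ => w (x - t)) u := fun u => by
          simp [indicator]
        simp only [h1]
        rw [← integral_Ioc_eq_integral_Ioo, setIntegral_indicator measurableSet_Iic,
          setIntegral_const, Ioc_inter_Iic, min_eq_right (hp.mem_Icc t).2,
          Real.volume_real_Ioc_of_le (hp.mem_Icc t).1]
        simp
    _ = ∫ u in Ioo (0 : ℝ) 1, ∫ t,
          {z : ℝ × ℝ | z.2 ≤ p z.1}.indicator (fun z => w (x - z.1)) (t, u) :=
        integral_integral_swap hind
    _ = ∫ u in Ioo (0 : ℝ) 1, windowCdf w (x - quantile p u) := by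
        refine setIntegral_congr_fun measurableSet_Ioo fun u hu => ?_
        have h1 : (fun t => {z : ℝ × ℝ | z.2 ≤ p z.1}.indicator (fun z => w (x - z.1)) (t, u))
            =ᵐ[volume] fun t => (Iic (x - quantile p u)).indicator w (x - t) := by
          filter_upwards [compl_mem_ae_iff.2 (measure_singleton (μ := volume) (quantile p u))]
            with t ht
          rcases lt_or_gt_of_ne (show t ≠ quantile p u from ht) with h | h
          · have h2 := lt_of_lt_quantile hm hp hu.1 h
            rw [indicator_of_notMem (show (t, u) ∉ {z : ℝ × ℝ | z.2 ≤ p z.1} from h2.not_ge),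
              indicator_of_notMem]
            rw [mem_Iic]
            exact fun hc => by linarith
          · have h2 := le_of_quantile_lt hm hp hu.2 h
            rw [indicator_of_mem (show (t, u) ∈ {z : ℝ × ℝ | z.2 ≤ p z.1} from h2),
              indicator_of_mem]
            rw [mem_Iic]
            linarith
        rw [integral_congr_ae h1,
          integral_sub_left_eq_self (fun t => (Iic (x - quantile p u)).indicator w t) volume x,
          integral_indicator measurableSet_Iic, windowCdf]

end Quantile

/-! ### Generalized inverses -/

section GenInv

variable {h : unitInterval → unitInterval}

theorem realExt_monotone (hh : IsUpdate h) : Monotone (realExt h) :=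
  Monotone.IccExtend (h := zero_le_one' ℝ) fun _ _ hab => hh.mono hab

theorem genInv_le {v r : ℝ} (hr : 0 ≤ r) (hv : v ≤ realExt h r) : genInv h v ≤ r := by
  have hmem : ((projIcc 0 1 (zero_le_one' ℝ) r : unitInterval) : ℝ) ∈
      {u : ℝ | ∃ hu : u ∈ unitInterval, v ≤ (h ⟨u, hu⟩ : ℝ)} :=
    ⟨(projIcc 0 1 (zero_le_one' ℝ) r).2, hv⟩
  refine (csInf_le ⟨0, fun u hu => hu.1.1⟩ hmem).trans ?_
  rw [coe_projIcc]
  exact max_le hr (min_le_right _ _)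

theorem le_genInv (hh : IsUpdate h) {v r : ℝ} (hv : v ≤ 1) (hr : ∀ u < r, realExt h u < v) :
    r ≤ genInv h v := by
  -- `v ≤ 1` puts 1 in the defining set; for an empty set `sInf` would be the default value 0.
  refine le_csInf ⟨1, unitInterval.one_mem, ?_⟩ ?_
  · have : h ⟨1, unitInterval.one_mem⟩ = 1 := hh.map_one
    rw [this]
    exact hv
  · rintro u ⟨hu, hvu⟩
    refine le_of_not_gt fun hlt => (hr u hlt).not_ge ?_
    rwa [realExt, IccExtend_of_mem _ _ hu]

end GenInv

/-- One-sided neighbourhoods have positive measure. With one-sided continuity, this transfers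
almost-everywhere statements to a given point. -/
theorem frequently_nhdsLT_of_ae {q : ℝ → Prop} {a b : ℝ}
    (hq : ∀ᵐ t ∂volume.restrict (Ioo a b), q t) {x : ℝ} (hx : x ∈ Ioc a b) :
    ∃ᶠ t in 𝓝[<] x, q t := by
  rw [ae_restrict_iff' measurableSet_Ioo] at hq
  intro hc
  obtain ⟨l, hl, hlx⟩ := (mem_nhdsLT_iff_exists_Ioo_subset' hx.1).1 hc
  have hpos : volume (Ioo (max l a) x) ≠ 0 := by
    rw [Real.volume_Ioo]
    simpa using max_lt hl hx.1
  refine hpos (measure_mono_null (fun t ht => ?_) (ae_iff.1 hq))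
  have h1 := hlx ⟨(le_max_left l a).trans_lt ht.1, ht.2⟩
  exact fun h2 => h1 (h2 ⟨(le_max_right l a).trans_lt ht.1, ht.2.trans_le hx.2⟩)

theorem frequently_nhdsGT_of_ae {q : ℝ → Prop} (hq : ∀ᵐ t : ℝ, q t) (x : ℝ) :
    ∃ᶠ t in 𝓝[>] x, q t := by
  intro hc
  obtain ⟨l, hl, hlx⟩ := (mem_nhdsGT_iff_exists_Ioo_subset).1 hc
  have hpos : volume (Ioo x l) ≠ 0 := by
    rw [Real.volume_Ioo]
    simpa using hl
  exact hpos (measure_mono_null (fun t ht => hlx ht) (ae_iff.1 hq))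

/-! ### Fixed points in terms of quantile functions -/

section FixedPoint

variable {w f g : ℝ → ℝ}

theorem windowAverage_continuous (hw : IsWindow w) (hg : Monotone g) (ig : IsInterpolating g) :
    Continuous (windowAverage g w) := by
  have h : windowAverage g w =
      fun x => ∫ u in Ioo (0 : ℝ) 1, windowCdf w (x - quantile g u) :=
    funext fun x => windowAverage_eq hw hg ig x
  rw [h]
  refine continuous_of_dominated (bound := fun _ => 1) (fun x => ?_) (fun x => ?_) ?_ ?_
  · exact ((windowCdf_continuous hw).measurable.comp_aemeasurable
      ((quantile_aemeasurable hg ig).const_sub x)).aestronglyMeasurable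
  · exact ae_of_all _ fun u => abs_windowCdf_le_one hw _
  · exact integrable_const _
  · exact ae_of_all _ fun u => (windowCdf_continuous hw).comp (continuous_id.sub continuous_const)

theorem windowAverage_nonneg (hw : IsWindow w) (hg : Monotone g) (ig : IsInterpolating g)
    (x : ℝ) : 0 ≤ windowAverage g w x := by
  rw [windowAverage_eq hw hg ig]
  exact integral_nonneg fun u => windowCdf_nonneg hw _

/-- One half of the fixed point equation, read off at the quantiles. -/
theorem integral_windowCdf_quantile {h : unitInterval → unitInterval} (hw : IsWindow w)
    (hh : IsUpdate h) (hf : Monotone f) (hg : Monotone g) (jf : IsInterpolating f)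
    (jg : IsInterpolating g) (hc : ∀ᵐ x : ℝ, Consistent h (windowAverage g w x) (f x)) {v : ℝ}
    (hv : v ∈ Ioo (0 : ℝ) 1) :
    ∫ u in Ioo (0 : ℝ) 1, windowCdf w (quantile f v - quantile g u) = genInv h v := by
  rw [← windowAverage_eq hw hg jg]
  have hG : Tendsto (windowAverage g w) (𝓝 (quantile f v))
      (𝓝 (windowAverage g w (quantile f v))) := (windowAverage_continuous hw hg jg).tendsto _
  refine le_antisymm ?_ ?_
  -- Just left of the quantile `f t < v`, so consistency puts the average at most at `genInv h v`;
  -- just right of it the inequalities reverse. Continuity of the average closes the squeeze.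
  · have hfr : ∃ᶠ t in 𝓝[<] (quantile f v), windowAverage g w t ≤ genInv h v := by
      have h1 : ∃ᶠ t in 𝓝[<] (quantile f v), Consistent h (windowAverage g w t) (f t) :=
        frequently_nhdsLT_of_ae (a := quantile f v - 1) (ae_restrict_of_ae hc)
          ⟨by linarith, le_rfl⟩
      refine (h1.and_eventually self_mem_nhdsWithin).mono fun t ht => ?_
      refine le_genInv hh hv.2.le fun u hu => ?_
      exact ((realExt_monotone hh).le_leftLim hu).trans_lt
        (ht.1.1.trans_lt (lt_of_lt_quantile hf jf hv.1 ht.2))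
    exact le_of_tendsto_of_frequently (hG.mono_left nhdsWithin_le_nhds) hfr
  · have hfr : ∃ᶠ t in 𝓝[>] (quantile f v), genInv h v ≤ windowAverage g w t := by
      have h1 : ∃ᶠ t in 𝓝[>] (quantile f v), Consistent h (windowAverage g w t) (f t) :=
        frequently_nhdsGT_of_ae hc _
      refine (h1.and_eventually self_mem_nhdsWithin).mono fun t ht => ?_
      refine le_of_forall_gt_imp_ge_of_dense fun r hr => ?_
      refine genInv_le ((windowAverage_nonneg hw hg jg t).trans hr.le) ?_
      exact (le_of_quantile_lt hf jf hv.2 ht.2).trans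
        (ht.1.2.trans ((realExt_monotone hh).rightLim_le hr))
    exact ge_of_tendsto_of_frequently (hG.mono_left nhdsWithin_le_nhds) hfr

end FixedPoint

/-! ### Rigidity -/

/-- A left-continuous function on an interval that vanishes almost everywhere vanishes. -/
theorem eq_zero_of_leftContinuous {k : ℝ → ℝ}
    (hk : ∀ᵐ t ∂volume.restrict (Ioo (0 : ℝ) 1), k t = 0) {x : ℝ} (hx : x ∈ Ioo (0 : ℝ) 1)
    (hc : ContinuousWithinAt k (Iio x) x) : k x = 0 := by
  have h := frequently_nhdsLT_of_ae hk ⟨hx.1, hx.2.le⟩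
  exact le_antisymm (le_of_tendsto_of_frequently (f := k) hc (h.mono fun t ht => ht.le))
    (ge_of_tendsto_of_frequently (f := k) hc (h.mono fun t ht => ht.ge))

theorem ae_sub_eq_zero_of_integral_eq_zero {α : Type*} [MeasurableSpace α] {ν : Measure α}
    {φ ψ : α → ℝ} (hφ : Integrable φ ν) (hψ : Integrable ψ ν) (h1 : ∫ z, φ z ∂ν = 0)
    (h2 : ∫ z, ψ z ∂ν = 0) (h : ∀ z, 0 ≤ φ z - ψ z) : ∀ᵐ z ∂ν, φ z - ψ z = 0 := by
  have h0 : ∫ z, (φ z - ψ z) ∂ν = 0 := by rw [integral_sub hφ hψ, h1, h2, sub_zero]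
  exact (integral_eq_zero_iff_of_nonneg (f := fun z => φ z - ψ z) h (hφ.sub hψ)).1 h0

/-- If two pairs of quantile functions have the same averages, then the displacements of the two
components agree at interacting points. -/
theorem displacement_eq {w : ℝ → ℝ} (hw : IsWindow w) (hsupp : IntervalSupport w)
    {x₀ y₀ x₁ y₁ : ℝ → ℝ}
    (mx₀ : AEMeasurable x₀ (volume.restrict (Ioo 0 1)))
    (my₀ : AEMeasurable y₀ (volume.restrict (Ioo 0 1)))
    (mx₁ : AEMeasurable x₁ (volume.restrict (Ioo 0 1)))
    (my₁ : AEMeasurable y₁ (volume.restrict (Ioo 0 1)))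
    (cx₀ : ∀ v ∈ Ioo (0 : ℝ) 1, ContinuousWithinAt x₀ (Iio v) v)
    (cy₀ : ∀ u ∈ Ioo (0 : ℝ) 1, ContinuousWithinAt y₀ (Iio u) u)
    (cx₁ : ∀ v ∈ Ioo (0 : ℝ) 1, ContinuousWithinAt x₁ (Iio v) v)
    (cy₁ : ∀ u ∈ Ioo (0 : ℝ) 1, ContinuousWithinAt y₁ (Iio u) u)
    (hv : ∀ v ∈ Ioo (0 : ℝ) 1, ∫ u in Ioo (0 : ℝ) 1, windowCdf w (x₀ v - y₀ u) =
      ∫ u in Ioo (0 : ℝ) 1, windowCdf w (x₁ v - y₁ u))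
    (hu : ∀ u ∈ Ioo (0 : ℝ) 1, ∫ v in Ioo (0 : ℝ) 1, windowCdf w (y₀ u - x₀ v) =
      ∫ v in Ioo (0 : ℝ) 1, windowCdf w (y₁ u - x₁ v))
    {u v : ℝ} (u01 : u ∈ Ioo (0 : ℝ) 1) (v01 : v ∈ Ioo (0 : ℝ) 1)
    (hpos : 0 < windowCdf w (x₀ v - y₀ u)) (hlt : windowCdf w (x₀ v - y₀ u) < 1) :
    x₁ v - x₀ v = y₁ u - y₀ u := by
  set μ : Measure ℝ := volume.restrict (Ioo 0 1) with hμ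
  set D : ℝ → ℝ → ℝ := fun u v => windowCdf w (x₁ v - y₁ u) - windowCdf w (x₀ v - y₀ u) with hD
  -- The arctangent keeps the order of displacements and makes them bounded, hence integrable
  -- against `D`.
  set A : ℝ → ℝ := fun v => Real.arctan (x₁ v - x₀ v) with hA
  set B : ℝ → ℝ := fun u => Real.arctan (y₁ u - y₀ u) with hB
  have cΩ := windowCdf_continuous hw
  have int_col : ∀ (p q : ℝ → ℝ), AEMeasurable p μ → AEMeasurable q μ →
      ∀ s, Integrable (fun u => windowCdf w (p s - q u)) μ := fun p q mp mq s =>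
    Integrable.of_bound ((cΩ.measurable.comp_aemeasurable
      (mq.const_sub (p s))).aestronglyMeasurable) 1 (ae_of_all _ fun _ => abs_windowCdf_le_one hw _)
  have hD_u : ∀ v ∈ Ioo (0 : ℝ) 1, ∫ u, D u v ∂μ = 0 := fun v hv01 => by
    rw [integral_sub (int_col x₁ y₁ mx₁ my₁ v) (int_col x₀ y₀ mx₀ my₀ v), hv v hv01, sub_self]
  have hD_v : ∀ u ∈ Ioo (0 : ℝ) 1, ∫ v, D u v ∂μ = 0 := fun u hu01 => by
    have h1 : ∀ v, D u v = windowCdf w (y₀ u - x₀ v) - windowCdf w (y₁ u - x₁ v) := fun v => by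
      simp only [hD]
      rw [windowCdf_sub_comm hw (x₁ v), windowCdf_sub_comm hw (x₀ v)]
      ring
    simp only [h1]
    rw [integral_sub (int_col y₀ x₀ my₀ mx₀ u) (int_col y₁ x₁ my₁ mx₁ u), hu u hu01, sub_self]
  have mD : AEStronglyMeasurable (fun z : ℝ × ℝ => D z.1 z.2) (μ.prod μ) :=
    ((cΩ.measurable.comp_aemeasurable (mx₁.comp_snd.sub my₁.comp_fst)).sub
      (cΩ.measurable.comp_aemeasurable (mx₀.comp_snd.sub my₀.comp_fst))).aestronglyMeasurable
  have mA : AEStronglyMeasurable (fun z : ℝ × ℝ => A z.2) (μ.prod μ) :=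
    (Real.measurable_arctan.comp_aemeasurable (mx₁.sub mx₀)).comp_snd.aestronglyMeasurable
  have mB : AEStronglyMeasurable (fun z : ℝ × ℝ => B z.1) (μ.prod μ) :=
    (Real.measurable_arctan.comp_aemeasurable (my₁.sub my₀)).comp_fst.aestronglyMeasurable
  have bD : ∀ u v, |D u v| ≤ 1 := fun u v => by
    have h1 := windowCdf_nonneg hw (x₁ v - y₁ u)
    have h2 := windowCdf_nonneg hw (x₀ v - y₀ u)
    have h3 := windowCdf_le_one hw (x₁ v - y₁ u)
    have h4 := windowCdf_le_one hw (x₀ v - y₀ u)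
    exact abs_le.2 ⟨by simp only [hD]; linarith, by simp only [hD]; linarith⟩
  have barc : ∀ r, |Real.arctan r| ≤ Real.pi / 2 := fun r =>
    abs_le.2 ⟨(Real.neg_pi_div_two_lt_arctan r).le, (Real.arctan_lt_pi_div_two r).le⟩
  have iDA : Integrable (fun z : ℝ × ℝ => D z.1 z.2 * A z.2) (μ.prod μ) :=
    Integrable.of_bound (mD.mul mA) (1 * (Real.pi / 2)) (ae_of_all _ fun z => by
      rw [Real.norm_eq_abs, abs_mul]
      exact mul_le_mul (bD _ _) (barc _) (abs_nonneg _) zero_le_one)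
  have iDB : Integrable (fun z : ℝ × ℝ => D z.1 z.2 * B z.1) (μ.prod μ) :=
    Integrable.of_bound (mD.mul mB) (1 * (Real.pi / 2)) (ae_of_all _ fun z => by
      rw [Real.norm_eq_abs, abs_mul]
      exact mul_le_mul (bD _ _) (barc _) (abs_nonneg _) zero_le_one)
  have zA : ∫ z, D z.1 z.2 * A z.2 ∂(μ.prod μ) = 0 := by
    rw [integral_prod_symm _ iDA]
    refine setIntegral_eq_zero_of_forall_eq_zero fun v hv01 => ?_
    simp only
    rw [integral_mul_const, hD_u v hv01, zero_mul]
  have zB : ∫ z, D z.1 z.2 * B z.1 ∂(μ.prod μ) = 0 := by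
    rw [integral_prod _ iDB]
    refine setIntegral_eq_zero_of_forall_eq_zero fun u hu01 => ?_
    simp only
    rw [integral_mul_const, hD_v u hu01, zero_mul]
  -- Both `D u v` and `A v - B u` follow the sign of (x₁ v - y₁ u) - (x₀ v - y₀ u).
  have hnn : ∀ u v, 0 ≤ D u v * A v - D u v * B u := fun u v => by
    rw [← mul_sub]
    rcases le_total (x₁ v - y₁ u) (x₀ v - y₀ u) with h | h
    · exact mul_nonneg_of_nonpos_of_nonpos (sub_nonpos.2 (windowCdf_mono hw h))
        (sub_nonpos.2 (Real.arctan_strictMono.monotone (by linarith)))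
    · exact mul_nonneg (sub_nonneg.2 (windowCdf_mono hw h))
        (sub_nonneg.2 (Real.arctan_strictMono.monotone (by linarith)))
  have hae : ∀ᵐ z ∂(μ.prod μ), D z.1 z.2 * A z.2 - D z.1 z.2 * B z.1 = 0 :=
    ae_sub_eq_zero_of_integral_eq_zero iDA iDB zA zB fun z => hnn z.1 z.2
  have hall : D u v * A v - D u v * B u = 0 := by
    -- Left continuity is used one variable at a time: in `v` for almost every first coordinate,
    -- then in `u`.
    refine eq_zero_of_leftContinuous (k := fun u => D u v * A v - D u v * B u) ?_ u01 ?_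
    · filter_upwards [Measure.ae_ae_of_ae_prod hae] with s hs
      refine eq_zero_of_leftContinuous (k := fun v => D s v * A v - D s v * B s) hs v01 ?_
      have c0 := cx₀ v v01
      have c1 := cx₁ v v01
      have cD : ContinuousWithinAt (fun v => D s v) (Iio v) v :=
        (cΩ.continuousAt.comp_continuousWithinAt (c1.sub continuousWithinAt_const)).sub
          (cΩ.continuousAt.comp_continuousWithinAt (c0.sub continuousWithinAt_const))
      exact (cD.mul (Real.continuous_arctan.continuousAt.comp_continuousWithinAt
        (c1.sub c0))).sub (cD.mul continuousWithinAt_const)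
    · have c0 := cy₀ u u01
      have c1 := cy₁ u u01
      have cD : ContinuousWithinAt (fun u => D u v) (Iio u) u :=
        (cΩ.continuousAt.comp_continuousWithinAt (continuousWithinAt_const.sub c1)).sub
          (cΩ.continuousAt.comp_continuousWithinAt (continuousWithinAt_const.sub c0))
      exact (cD.mul continuousWithinAt_const).sub
        (cD.mul (Real.continuous_arctan.continuousAt.comp_continuousWithinAt (c1.sub c0)))
  rw [← mul_sub, mul_eq_zero] at hall
  rcases hall with h | h
  · have := eq_of_windowCdf_eq hw hsupp hpos hlt (sub_eq_zero.1 h).symm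
    linarith
  · exact Real.arctan_injective (sub_eq_zero.1 h)

/-! ### Connectedness from the gap condition -/

/-- Points on the line carrying labels have a single label if over every position there is a
pair of points, one on either side, inside an open interval of equally labelled points. -/
theorem label_eq_of_bridges {ι : Type*} (z val : ι → ℝ) {I : Set ℝ} (hI : I.OrdConnected)
    (hz : ∀ i, z i ∈ I)
    (hb : ∀ t ∈ I, ∃ i j, ∃ J : Set ℝ, IsOpen J ∧ J.OrdConnected ∧ z i ≤ t ∧ t ≤ z j ∧
      z i ∈ J ∧ z j ∈ J ∧ ∀ k, z k ∈ J → val k = val i) (k l : ι) : val k = val l := by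
  have : Nonempty ι := ⟨k⟩
  choose! L R J hopen hconn hL hR hLJ hRJ hval using hb
  -- The intervals `J t` and `J t'` share a labelled point: if `z (L t')` is not in `J t`, it lies
  -- left of `z (L t)`. Then either `z (L t)` lies in `J t'`, or `z (R t')` lies between `z (L t)`
  -- and `t'`, hence in `J t`.
  have key : ∀ t ∈ I, ∀ t' ∈ I, t' ∈ J t → val (L t) = val (L t') := by
    intro t ht t' ht' hJ
    by_cases h1 : z (L t') ∈ J t
    · exact (hval t ht _ h1).symm
    have h2 : z (L t') < z (L t) := by
      by_contra! hc
      exact h1 ((hconn t ht).out (hLJ t ht) hJ ⟨hc, hL t' ht'⟩)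
    by_cases h3 : z (L t) ≤ z (R t')
    · exact hval t' ht' _ ((hconn t' ht').out (hLJ t' ht') (hRJ t' ht') ⟨h2.le, h3⟩)
    · have h4 : z (R t') ∈ J t :=
        (hconn t ht).out hJ (hLJ t ht) ⟨hR t' ht', (not_le.1 h3).le⟩
      exact (hval t ht _ h4).symm.trans (hval t' ht' _ (hRJ t' ht'))
  have hmem : ∀ t ∈ I, t ∈ J t := fun t ht =>
    (hconn t ht).out (hLJ t ht) (hRJ t ht) ⟨hL t ht, hR t ht⟩
  -- By `key` the label of `L t` is locally constant on the preconnected set `I`.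
  have hconst := hI.isPreconnected.induction₂' (fun s t => val (L s) = val (L t))
    (fun s hs => by
      filter_upwards [self_mem_nhdsWithin,
        mem_nhdsWithin_of_mem_nhds ((hopen s hs).mem_nhds (hmem s hs))] with t ht htJ
      exact ⟨key s hs t ht htJ, (key s hs t ht htJ).symm⟩)
    (fun _ _ _ _ _ _ h h' => h.trans h') (hz k) (hz l)
  rw [hval _ (hz k) k (hmem _ (hz k)), hval _ (hz l) l (hmem _ (hz l))]
  exact hconst

/-- A positive potential at `(c, d)` forces an interaction across the splitting at `(c, d)`. -/
theorem exists_interaction_of_potential_pos {w : ℝ → ℝ} (hw : IsWindow w)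
    {hf hg : unitInterval → unitInterval} {x y : ℝ → ℝ}
    (mx : AEMeasurable x (volume.restrict (Ioo 0 1)))
    (my : AEMeasurable y (volume.restrict (Ioo 0 1)))
    (hx : ∀ v ∈ Ioo (0 : ℝ) 1, ∫ u in Ioo (0 : ℝ) 1, windowCdf w (x v - y u) = genInv hf v)
    (hy : ∀ u ∈ Ioo (0 : ℝ) 1, ∫ v in Ioo (0 : ℝ) 1, windowCdf w (y u - x v) = genInv hg u)
    {c d : ℝ} (hc : c ∈ Icc (0 : ℝ) 1) (hd : d ∈ Icc (0 : ℝ) 1)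
    (hpos : 0 < potential hf hg c d) :
    (∃ u ∈ Ioo 0 c, ∃ v ∈ Ioo d 1, 0 < windowCdf w (y u - x v)) ∨
      ∃ u ∈ Ioo c 1, ∃ v ∈ Ioo 0 d, 0 < windowCdf w (x v - y u) := by
  by_contra! hno
  obtain ⟨h1, h2⟩ := hno
  have restr : ∀ (k : ℝ → ℝ) (e : ℝ), e ∈ Icc (0 : ℝ) 1 → (∀ s ∈ Ioo e 1, k s = 0) →
      ∫ s in Ioo (0 : ℝ) 1, k s = ∫ s in Ioo 0 e, k s := fun k e he hk => by
    refine setIntegral_eq_of_subset_of_ae_sdiff_eq_zero measurableSet_Ioo.nullMeasurableSet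
      (Ioo_subset_Ioo_right he.2) ?_
    filter_upwards [compl_mem_ae_iff.2 (measure_singleton (μ := volume) e)] with s hs hmem
    have hne : s ≠ e := hs
    refine hk s ⟨lt_of_le_of_ne (le_of_not_gt fun hlt => hmem.2 ⟨hmem.1.1, hlt⟩) hne.symm,
      hmem.1.2⟩
  have e1 : ∫ u in (0 : ℝ)..c, genInv hg u =
      ∫ u in Ioo 0 c, ∫ v in Ioo 0 d, windowCdf w (y u - x v) := by
    rw [intervalIntegral.integral_of_le hc.1, integral_Ioc_eq_integral_Ioo]
    refine setIntegral_congr_fun measurableSet_Ioo fun u hu => ?_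
    rw [← hy u ⟨hu.1, hu.2.trans_le hc.2⟩]
    exact restr _ d hd fun v hv => le_antisymm (h1 u hu v hv) (windowCdf_nonneg hw _)
  have e2 : ∫ v in (0 : ℝ)..d, genInv hf v =
      ∫ v in Ioo 0 d, ∫ u in Ioo 0 c, windowCdf w (x v - y u) := by
    rw [intervalIntegral.integral_of_le hd.1, integral_Ioc_eq_integral_Ioo]
    refine setIntegral_congr_fun measurableSet_Ioo fun v hv => ?_
    rw [← hx v ⟨hv.1, hv.2.trans_le hd.2⟩]
    exact restr _ c hc fun u hu => le_antisymm (h2 u hu v hv) (windowCdf_nonneg hw _)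
  have my' : AEMeasurable y (volume.restrict (Ioo 0 c)) :=
    my.mono_measure (Measure.restrict_mono (Ioo_subset_Ioo_right hc.2) le_rfl)
  have mx' : AEMeasurable x (volume.restrict (Ioo 0 d)) :=
    mx.mono_measure (Measure.restrict_mono (Ioo_subset_Ioo_right hd.2) le_rfl)
  have cΩ := (windowCdf_continuous hw).measurable
  have hswap := integral_integral_swap (f := fun u v => windowCdf w (y u - x v))
    (μ := volume.restrict (Ioo 0 c)) (ν := volume.restrict (Ioo 0 d))
    (Integrable.of_bound
      (cΩ.comp_aemeasurable (my'.comp_fst.sub mx'.comp_snd)).aestronglyMeasurable 1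
      (ae_of_all _ fun _ => abs_windowCdf_le_one hw _))
  have hinner : ∀ v, ∫ u in Ioo 0 c, windowCdf w (x v - y u) =
      c - ∫ u in Ioo 0 c, windowCdf w (y u - x v) := fun v => by
    have hi : Integrable (fun u => windowCdf w (y u - x v)) (volume.restrict (Ioo 0 c)) :=
      Integrable.of_bound (cΩ.comp_aemeasurable (my'.sub_const _)).aestronglyMeasurable 1
        (ae_of_all _ fun _ => abs_windowCdf_le_one hw _)
    simp only [windowCdf_sub_comm hw (x v)]
    rw [integral_sub (integrable_const _) hi, setIntegral_const, Real.volume_real_Ioo_of_le hc.1]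
    simp
  -- Both integrals now live on the rectangle (0,c) × (0,d), where Ω(z) + Ω(-z) = 1 makes their sum
  -- the area c·d.
  have hfin : potential hf hg c d = 0 := by
    rw [potential, e1, e2, hswap]
    simp only [hinner]
    rw [integral_sub (integrable_const _), setIntegral_const, Real.volume_real_Ioo_of_le hd.1]
    · simp only [sub_zero, smul_eq_mul]
      ring
    · refine Integrable.integral_prod_right (f := fun z : ℝ × ℝ => windowCdf w (y z.1 - x z.2))
        (μ := volume.restrict (Ioo 0 c)) (Integrable.of_bound
        (cΩ.comp_aemeasurable (my'.comp_fst.sub mx'.comp_snd)).aestronglyMeasurable 1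
        (ae_of_all _ fun _ => abs_windowCdf_le_one hw _))
  exact hpos.ne' hfin

/-! ### Uniqueness up to translation -/

/-! ### From quantile functions back to profiles -/

section Monotone

variable {p : ℝ → ℝ}

theorem rightLim_mem_Icc (hm : Monotone p) (hp : IsInterpolating p) (t : ℝ) :
    Function.rightLim p t ∈ Icc (0 : ℝ) 1 :=
  ⟨(hp.mem_Icc t).1.trans (hm.le_rightLim le_rfl),
    (hm.rightLim_le (lt_add_one t)).trans (hp.mem_Icc _).2⟩

theorem leftLim_mem_Icc (hm : Monotone p) (hp : IsInterpolating p) (t : ℝ) :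
    Function.leftLim p t ∈ Icc (0 : ℝ) 1 :=
  ⟨(hp.mem_Icc _).1.trans (hm.le_leftLim (sub_one_lt t)),
    (hm.leftLim_le le_rfl).trans (hp.mem_Icc t).2⟩

theorem quantile_le_of_lt_rightLim (hm : Monotone p) (hp : IsInterpolating p) {v t : ℝ}
    (hv : 0 < v) (h : v < Function.rightLim p t) : quantile p v ≤ t :=
  le_of_forall_gt_imp_ge_of_dense fun _ hs =>
    quantile_le hm hp hv (h.le.trans (hm.rightLim_le hs))

theorem le_quantile_of_leftLim_lt (hm : Monotone p) (hp : IsInterpolating p) {v t : ℝ}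
    (hv : v < 1) (h : Function.leftLim p t < v) : t ≤ quantile p v :=
  le_of_forall_lt_imp_le_of_dense fun _ hs =>
    le_quantile hm hp hv ((hm.le_leftLim hs).trans_lt h)

theorem le_rightLim_quantile (hm : Monotone p) (hp : IsInterpolating p) {v : ℝ} (hv : v < 1) :
    v ≤ Function.rightLim p (quantile p v) := by
  have h := hm.tendsto_rightLim (quantile p v)
  exact ge_of_tendsto h (eventually_mem_nhdsWithin.mono fun t ht => le_of_quantile_lt hm hp hv ht)

theorem leftLim_quantile_le (hm : Monotone p) (hp : IsInterpolating p) {v : ℝ} (hv : 0 < v) :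
    Function.leftLim p (quantile p v) ≤ v := by
  have h := hm.tendsto_leftLim (quantile p v)
  exact le_of_tendsto h
    (eventually_mem_nhdsWithin.mono fun t ht => (lt_of_lt_quantile hm hp hv ht).le)

/-- Quantiles do not determine the value of a profile at a jump; the gap `s < t` absorbs this
ambiguity. -/
theorem le_translate_of_quantile {q : ℝ → ℝ} (hm : Monotone p) (hp : IsInterpolating p)
    (hq : Monotone q) (iq : IsInterpolating q) {κ : ℝ}
    (h : ∀ v ∈ Ioo (0 : ℝ) 1, quantile q v - quantile p v = κ) {s t : ℝ} (hst : s < t) :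
    q s ≤ p (t - κ) ∧ p (s - κ) ≤ q t := by
  constructor
  · refine le_of_forall_lt_imp_le_of_dense fun v hv => ?_
    rcases le_or_gt v 0 with h0 | h0
    · exact h0.trans (hp.mem_Icc _).1
    have h1 : v < 1 := hv.trans_le (iq.mem_Icc s).2
    have h2 := quantile_le hq iq h0 hv.le
    exact le_of_quantile_lt hm hp h1 (by linarith [h v ⟨h0, h1⟩])
  · refine le_of_forall_lt_imp_le_of_dense fun v hv => ?_
    rcases le_or_gt v 0 with h0 | h0
    · exact h0.trans (iq.mem_Icc _).1
    have h1 : v < 1 := hv.trans_le (hp.mem_Icc _).2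
    have h2 := quantile_le hm hp h0 hv.le
    exact le_of_quantile_lt hq iq h1 (by linarith [h v ⟨h0, h1⟩])

/-- Let `t` decrease to `s` at common continuity points; monotone functions have only countably many
discontinuities. -/
theorem ae_eq_translate_of_quantile {q : ℝ → ℝ} (hm : Monotone p) (hp : IsInterpolating p)
    (hq : Monotone q) (iq : IsInterpolating q) {κ : ℝ}
    (h : ∀ v ∈ Ioo (0 : ℝ) 1, quantile q v - quantile p v = κ) :
    ∀ᵐ s : ℝ, q s = p (s + -κ) := by
  have hm' : Monotone fun s => p (s + -κ) := fun a b hab => hm (by linarith)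
  have h1 : ∀ᵐ s : ℝ, ContinuousAt q s := (hq.countable_not_continuousAt.measure_zero volume)
  have h2 : ∀ᵐ s : ℝ, ContinuousAt (fun s => p (s + -κ)) s :=
    (hm'.countable_not_continuousAt.measure_zero volume)
  filter_upwards [h1, h2] with s c1 c2
  refine le_antisymm ?_ ?_
  · exact ge_of_tendsto (c2.tendsto.mono_left (nhdsWithin_le_nhds (s := Ioi s)))
      (eventually_mem_nhdsWithin.mono fun t ht =>
        (le_translate_of_quantile hm hp hq iq h ht).1)
  · exact ge_of_tendsto (c1.tendsto.mono_left (nhdsWithin_le_nhds (s := Ioi s)))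
      (eventually_mem_nhdsWithin.mono fun t ht =>
        (le_translate_of_quantile hm hp hq iq h ht).2)

end Monotone

/-- The points at positions interacting with both of two interacting points form an open interval
containing these two. -/
theorem exists_bridge {w : ℝ → ℝ} (hw : IsWindow w) {x y a b : ℝ → ℝ}
    (hab : ∀ u ∈ Ioo (0 : ℝ) 1, ∀ v ∈ Ioo (0 : ℝ) 1, 0 < windowCdf w (x v - y u) →
      windowCdf w (x v - y u) < 1 → a v = b u) {u v : ℝ} (hu : u ∈ Ioo (0 : ℝ) 1)
    (hv : v ∈ Ioo (0 : ℝ) 1) (h0 : 0 < windowCdf w (x v - y u))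
    (h1 : windowCdf w (x v - y u) < 1) :
    ∃ J : Set ℝ, IsOpen J ∧ J.OrdConnected ∧ x v ∈ J ∧ y u ∈ J ∧
      (∀ v' ∈ Ioo (0 : ℝ) 1, x v' ∈ J → a v' = b u) ∧
      ∀ u' ∈ Ioo (0 : ℝ) 1, y u' ∈ J → b u' = b u := by
  have cΩ := windowCdf_continuous hw
  have mΩ := windowCdf_mono hw
  have hz : windowCdf w 0 = 1 / 2 := windowCdf_zero hw
  -- The first condition controls labels of `x`-points through `y u`, the second those of `y`-points
  -- through `x v`. Each endpoint satisfies the condition centred at itself because Ω(0) = 1/2.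
  refine ⟨{s | windowCdf w (s - y u) ∈ Ioo (0 : ℝ) 1} ∩ {s | windowCdf w (x v - s) ∈ Ioo (0 : ℝ) 1},
    ?_, ?_, ⟨⟨h0, h1⟩, ?_⟩, ⟨?_, ⟨h0, h1⟩⟩, ?_, ?_⟩
  · exact (isOpen_Ioo.preimage (cΩ.comp (continuous_id.sub continuous_const))).inter
      (isOpen_Ioo.preimage (cΩ.comp (continuous_const.sub continuous_id)))
  · refine ⟨fun s hs t ht r hr => ⟨⟨?_, ?_⟩, ⟨?_, ?_⟩⟩⟩
    · exact hs.1.1.trans_le (mΩ (by linarith [hr.1]))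
    · exact (mΩ (by linarith [hr.2])).trans_lt ht.1.2
    · exact ht.2.1.trans_le (mΩ (by linarith [hr.2]))
    · exact (mΩ (by linarith [hr.1])).trans_lt hs.2.2
  · simp only [mem_ofPred_eq, sub_self, hz]
    norm_num
  · simp only [mem_ofPred_eq, sub_self, hz]
    norm_num
  · exact fun v' hv' hJ => hab u hu v' hv' hJ.1.1 hJ.1.2
  · exact fun u' hu' hJ =>
      (hab u' hu' v hv hJ.2.1 hJ.2.2).symm.trans (hab u hu v hv h0 h1)

/-- Displacements that agree at interacting points are constant under the gap condition. -/
theorem displacement_const {w : ℝ → ℝ} (hw : IsWindow w) {hf hg : unitInterval → unitInterval}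
    (hgap : StrictlyPositiveGap hf hg) {f g : ℝ → ℝ} (mf : Monotone f) (mg : Monotone g)
    (jf : IsInterpolating f) (jg : IsInterpolating g)
    (hx : ∀ v ∈ Ioo (0 : ℝ) 1,
      ∫ u in Ioo (0 : ℝ) 1, windowCdf w (quantile f v - quantile g u) = genInv hf v)
    (hy : ∀ u ∈ Ioo (0 : ℝ) 1,
      ∫ v in Ioo (0 : ℝ) 1, windowCdf w (quantile g u - quantile f v) = genInv hg u)
    {a b : ℝ → ℝ}
    (hab : ∀ u ∈ Ioo (0 : ℝ) 1, ∀ v ∈ Ioo (0 : ℝ) 1,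
      0 < windowCdf w (quantile f v - quantile g u) →
      windowCdf w (quantile f v - quantile g u) < 1 → a v = b u) :
    ∃ κ, (∀ v ∈ Ioo (0 : ℝ) 1, a v = κ) ∧ ∀ u ∈ Ioo (0 : ℝ) 1, b u = κ := by
  set x := quantile f with hxdef
  set y := quantile g with hydef
  -- The quantiles of both profiles are placed on one line, labelled by their displacements.
  let z : Ioo (0 : ℝ) 1 ⊕ Ioo (0 : ℝ) 1 → ℝ := Sum.elim (fun v => x v) fun u => y u
  let val : Ioo (0 : ℝ) 1 ⊕ Ioo (0 : ℝ) 1 → ℝ := Sum.elim (fun v => a v) fun u => b u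
  let I : Set ℝ := {t | 0 < Function.rightLim f t + Function.rightLim g t ∧
    Function.leftLim f t + Function.leftLim g t < 2}
  have hI : I.OrdConnected := ⟨fun s hs t ht r hr =>
    ⟨hs.1.trans_le (add_le_add (mf.rightLim hr.1) (mg.rightLim hr.1)),
      (add_le_add (mf.leftLim hr.2) (mg.leftLim hr.2)).trans_lt ht.2⟩⟩
  have hz : ∀ i, z i ∈ I := by
    rintro (⟨v, hv⟩ | ⟨u, hu⟩)
    · have h1 := le_rightLim_quantile mf jf hv.2
      have h2 := leftLim_quantile_le mf jf hv.1
      have h3 := (rightLim_mem_Icc mg jg (x v)).1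
      have h4 := (leftLim_mem_Icc mg jg (x v)).2
      exact ⟨by simp only [z, Sum.elim_inl]; linarith [hv.1],
        by simp only [z, Sum.elim_inl]; linarith [hv.2]⟩
    · have h1 := le_rightLim_quantile mg jg hu.2
      have h2 := leftLim_quantile_le mg jg hu.1
      have h3 := (rightLim_mem_Icc mf jf (y u)).1
      have h4 := (leftLim_mem_Icc mf jf (y u)).2
      exact ⟨by simp only [z, Sum.elim_inr]; linarith [hu.1],
        by simp only [z, Sum.elim_inr]; linarith [hu.2]⟩
  have hhalf : windowCdf w 0 < 1 := by
    rw [windowCdf_zero hw]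
    norm_num
  have hlt1 : ∀ s, s ≤ 0 → windowCdf w s < 1 := fun s hs => (windowCdf_mono hw hs).trans_lt hhalf
  have hb : ∀ t ∈ I, ∃ i j, ∃ J : Set ℝ, IsOpen J ∧ J.OrdConnected ∧ z i ≤ t ∧ t ≤ z j ∧
      z i ∈ J ∧ z j ∈ J ∧ ∀ k, z k ∈ J → val k = val i := by
    intro t ht
    have rf := rightLim_mem_Icc mf jf t
    have rg := rightLim_mem_Icc mg jg t
    have lf := leftLim_mem_Icc mf jf t
    have lg := leftLim_mem_Icc mg jg t
    have lrf := mf.leftLim_le_rightLim (le_refl t)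
    have lrg := mg.leftLim_le_rightLim (le_refl t)
    have ht1 := ht.1
    have ht2 := ht.2
    -- Midpoints of the jumps at `t` give (0,0) only if both right limits are 0, and (1,1) only if
    -- both left limits are 1. Membership in `I` excludes both cases, so the potential is positive.
    set c := (Function.leftLim g t + Function.rightLim g t) / 2 with hc
    set d := (Function.leftLim f t + Function.rightLim f t) / 2 with hd
    have hc01 : c ∈ Icc (0 : ℝ) 1 := ⟨by linarith [lg.1, rg.1], by linarith [lg.2, rg.2]⟩
    have hd01 : d ∈ Icc (0 : ℝ) 1 := ⟨by linarith [lf.1, rf.1], by linarith [lf.2, rf.2]⟩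
    have hpot : 0 < potential hf hg c d := by
      refine hgap.2 c hc01 d hd01 (fun h => ?_) fun h => ?_
      · obtain ⟨h1, h2⟩ := Prod.mk.inj h
        linarith [lf.1, lg.1]
      · obtain ⟨h1, h2⟩ := Prod.mk.inj h
        linarith [rf.2, rg.2]
    rcases exists_interaction_of_potential_pos hw (quantile_aemeasurable mf jf)
      (quantile_aemeasurable mg jg) hx hy hc01 hd01 hpot with
      ⟨u, hu, v, hv, huv⟩ | ⟨u, hu, v, hv, huv⟩
    · have hu1 : u ∈ Ioo (0 : ℝ) 1 := ⟨hu.1, hu.2.trans_le hc01.2⟩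
      have hv1 : v ∈ Ioo (0 : ℝ) 1 := ⟨hd01.1.trans_lt hv.1, hv.2⟩
      have hyt : y u ≤ t := quantile_le_of_lt_rightLim mg jg hu1.1 (by linarith [hu.2])
      have hxt : t ≤ x v := le_quantile_of_leftLim_lt mf jf hv1.2 (by linarith [hv.1])
      -- Since `y u ≤ t ≤ x v`, Ω(y u - x v) ≤ 1/2; with its positivity and the reflection identity,
      -- Ω(x v - y u) lies strictly between 0 and 1.
      have h2 := hlt1 (y u - x v) (by linarith)
      have h3 := windowCdf_sub_comm hw (y u) (x v)
      obtain ⟨J, hJ, hJc, hxJ, hyJ, hxv, hyv⟩ :=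
        exists_bridge hw hab hu1 hv1 (by linarith) (by linarith)
      refine ⟨.inr ⟨u, hu1⟩, .inl ⟨v, hv1⟩, J, hJ, hJc, hyt, hxt, hyJ, hxJ, ?_⟩
      rintro (⟨v', hv'⟩ | ⟨u', hu'⟩) hk
      · exact hxv v' hv' hk
      · exact hyv u' hu' hk
    · have hu1 : u ∈ Ioo (0 : ℝ) 1 := ⟨hc01.1.trans_lt hu.1, hu.2⟩
      have hv1 : v ∈ Ioo (0 : ℝ) 1 := ⟨hv.1, hv.2.trans_le hd01.2⟩
      have hyt : t ≤ y u := le_quantile_of_leftLim_lt mg jg hu1.2 (by linarith [hu.1])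
      have hxt : x v ≤ t := quantile_le_of_lt_rightLim mf jf hv1.1 (by linarith [hv.2])
      obtain ⟨J, hJ, hJc, hxJ, hyJ, hxv, hyv⟩ :=
        exists_bridge hw hab hu1 hv1 huv (hlt1 _ (by linarith))
      refine ⟨.inl ⟨v, hv1⟩, .inr ⟨u, hu1⟩, J, hJ, hJc, hxt, hyt, hxJ, hyJ, ?_⟩
      have hvu : a v = b u := hxv v hv1 hxJ
      rintro (⟨v', hv'⟩ | ⟨u', hu'⟩) hk
      · exact (hxv v' hv' hk).trans hvu.symm
      · exact (hyv u' hu' hk).trans hvu.symm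
  have hconst := label_eq_of_bridges z val hI hz hb
  have hmid : (1 / 2 : ℝ) ∈ Ioo (0 : ℝ) 1 := by norm_num
  exact ⟨a (1 / 2), fun v hv => hconst (.inl ⟨v, hv⟩) (.inl ⟨1 / 2, hmid⟩),
    fun u hu => hconst (.inr ⟨u, hu⟩) (.inl ⟨1 / 2, hmid⟩)⟩

end SpatialCoupling

end

theorem mainTheorem3
    (w : ℝ → ℝ) (hw : SpatialCoupling.IsWindow w) (hCw : SpatialCoupling.FiniteCw w)
    (hsupp : SpatialCoupling.IntervalSupport w)
    (hf hg : unitInterval → unitInterval)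
    (hhf : SpatialCoupling.IsUpdate hf) (hhg : SpatialCoupling.IsUpdate hg)
    (hgap : SpatialCoupling.StrictlyPositiveGap hf hg)
    (f₀ g₀ f₁ g₁ : ℝ → ℝ)
    (hf₀ : Monotone f₀) (hg₀ : Monotone g₀) (hf₁ : Monotone f₁) (hg₁ : Monotone g₁)
    (h₀ : SpatialCoupling.IsCFP hf hg w f₀ g₀)
    (h₁ : SpatialCoupling.IsCFP hf hg w f₁ g₁) :
    ∃ m : ℝ, ∀ᵐ x : ℝ, f₁ x = f₀ (x + m) ∧ g₁ x = g₀ (x + m) := by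
  have ex {f g : ℝ → ℝ} (mf : Monotone f) (mg : Monotone g)
      (h : SpatialCoupling.IsCFP hf hg w f g) :=
    fun v hv => SpatialCoupling.integral_windowCdf_quantile (v := v) hw hhf mf mg
      h.interp_f h.interp_g h.eq_f hv
  have ey {f g : ℝ → ℝ} (mf : Monotone f) (mg : Monotone g)
      (h : SpatialCoupling.IsCFP hf hg w f g) :=
    fun u hu => SpatialCoupling.integral_windowCdf_quantile (v := u) hw hhg mg mf
      h.interp_g h.interp_f h.eq_g hu
  obtain ⟨κ, hκx, hκy⟩ := SpatialCoupling.displacement_const hw hgap hf₀ hg₀ h₀.interp_f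
    h₀.interp_g (ex hf₀ hg₀ h₀) (ey hf₀ hg₀ h₀)
    (a := fun v => SpatialCoupling.quantile f₁ v - SpatialCoupling.quantile f₀ v)
    (b := fun u => SpatialCoupling.quantile g₁ u - SpatialCoupling.quantile g₀ u)
    fun u hu v hv hpos hlt => SpatialCoupling.displacement_eq hw hsupp
      (SpatialCoupling.quantile_aemeasurable hf₀ h₀.interp_f)
      (SpatialCoupling.quantile_aemeasurable hg₀ h₀.interp_g)
      (SpatialCoupling.quantile_aemeasurable hf₁ h₁.interp_f)
      (SpatialCoupling.quantile_aemeasurable hg₁ h₁.interp_g)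
      (fun _ h => SpatialCoupling.quantile_leftContinuous hf₀ h₀.interp_f h)
      (fun _ h => SpatialCoupling.quantile_leftContinuous hg₀ h₀.interp_g h)
      (fun _ h => SpatialCoupling.quantile_leftContinuous hf₁ h₁.interp_f h)
      (fun _ h => SpatialCoupling.quantile_leftContinuous hg₁ h₁.interp_g h)
      (fun v hv => (ex hf₀ hg₀ h₀ v hv).trans (ex hf₁ hg₁ h₁ v hv).symm)
      (fun u hu => (ey hf₀ hg₀ h₀ u hu).trans (ey hf₁ hg₁ h₁ u hu).symm) hu hv hpos hlt
  refine ⟨-κ, ?_⟩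
  filter_upwards [
    SpatialCoupling.ae_eq_translate_of_quantile hf₀ h₀.interp_f hf₁ h₁.interp_f hκx,
    SpatialCoupling.ae_eq_translate_of_quantile hg₀ h₀.interp_g hg₁ h₁.interp_g hκy]
    with s hs1 hs2
  exact ⟨hs1, hs2⟩
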